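/- Let $\mathbb{H}\subset\mathbb{R}^2$ be the set of sites of the honeycomb lattice whose bonds have length $1$, placed so that $(0,0)$ and $(1,0)$ are neighbouring sites. Each site $\mathbf{h}\in\mathbb{H}$ carries a scatterer, whose orientation at time $t\in\{0,1,2,\dots\}$ is $C(t,\mathbf{h})\in\{-1,1\}$, where $-1$ means a left and $1$ a right scatterer. For $z\in\{-1,1\}$ put $$R[z]=\begin{pmatrix}\cos(\tfrac{\pi}{3}z)&\sin(\tfrac{\pi}{3}z)\\-\sin(\tfrac{\pi}{3}z)&\cos(\tfrac{\pi}{3}z)\end{pmatrix}.$$ A particle with initial position $\mathbf{r}(0)=(0,0)$ and initial velocity $\mathbf{v}(0)=(1,0)$ moves according to $$\mathbf{r}(t+1)=\mathbf{r}(t)+\mathbf{v}(t),\qquad \mathbf{v}(t+1)=R\big[C(t,\mathbf{r}(t+1))\big]\mathbf{v}(t),$$ $$C(t+1,\mathbf{h})=\begin{cases}-C(t,\mathbf{h})&\text{if }\mathbf{h}=\mathbf{r}(t+1),\\ C(t,\mathbf{h})&\text{otherwise,}\end{cases}\qquad t\ge 0.$$ Let $p\in(0,1)$, and let the initial orientations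 $C(0,\mathbf{h})$, $\mathbf{h}\in\mathbb{H}$, be independent random variables with $\mathbb{P}[C(0,\mathbf{h})=1]=p$ for every $\mathbf{h}\in\mathbb{H}$. Then, with probability $1$, the trajectory of the particle is periodic: there is an integer $t_p\geq 1$ such that $\mathbf{r}(t)=\mathbf{r}(t+t_p)$ for all $t\ge 0$. -/

import Mathlib

/-! The flipping rotator model on the honeycomb lattice. -/

namespace FlippingRotator

/-- The Euclidean plane. -/
abbrev Plane : Type := EuclideanSpace ℝ (Fin 2)

/-- The point `m • (1, 0) + n • (1/2, √3/2)` of the triangular lattice of side length one. -/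
noncomputable def latticePoint (m n : ℤ) : Plane :=
  !₂[(m : ℝ) + (n : ℝ) / 2, (n : ℝ) * (√3 / 2)]

/-- The set of sites of the honeycomb lattice with bonds of unit length, placed so that `(0, 0)` and
`(1, 0)` are neighbouring sites: it is the triangular lattice of side length one from which the
centres of the hexagons (the points with `m - n ≡ 2` modulo `3`) are removed. -/
def honeycomb : Set Plane :=
  {x | ∃ m n : ℤ, ¬ (m - n ≡ 2 [ZMOD 3]) ∧ x = latticePoint m n}

/-- The sites of the honeycomb lattice. -/
abbrev Site : Type := honeycomb

/-- The honeycomb lattice as a graph; its bonds join the sites at distance one. -/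
def honeycombGraph : SimpleGraph Site where
  Adj x y := dist (x : Plane) (y : Plane) = 1
  symm := ⟨fun x y h => by rw [dist_comm]; exact h⟩
  loopless := ⟨fun x h => by simp at h⟩

/-- A configuration of scatterers: the orientation at a site is `-1` for a left scatterer and `1`
for a right scatterer. -/
abbrev Configuration : Type := Site → ℤˣ

/-- The rotation matrix `R[z]`: rotation by `π/3` to the right if `z = 1`, to the left if
`z = -1`. -/
noncomputable def rotationMatrix (z : ℤˣ) : Matrix (Fin 2) (Fin 2) ℝ :=
  !![Real.cos (Real.pi / 3 * ((z : ℤ) : ℝ)), Real.sin (Real.pi / 3 * ((z : ℤ) : ℝ));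
    -Real.sin (Real.pi / 3 * ((z : ℤ) : ℝ)), Real.cos (Real.pi / 3 * ((z : ℤ) : ℝ))]

/-- The velocity `R[z] v`. -/
noncomputable def rotate (z : ℤˣ) (v : Plane) : Plane :=
  WithLp.toLp 2 ((rotationMatrix z).mulVec v.ofLp)

/-- A state of the system: the position of the particle, its velocity (just after being scattered),
which has unit length and points along a bond to a neighbouring site, and the configuration. -/
@[ext]
structure State where
  pos : Site
  vel : Plane
  conf : Configuration
  norm_vel : ‖vel‖ = 1
  mem : (pos : Plane) + vel ∈ honeycomb

theorem latticePoint_add (m n a b : ℤ) :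
    latticePoint m n + latticePoint a b = latticePoint (m + a) (n + b) := by
  ext i
  fin_cases i <;> simp [latticePoint] <;> ring

theorem latticePoint_sub (m n a b : ℤ) :
    latticePoint m n - latticePoint a b = latticePoint (m - a) (n - b) := by
  ext i
  fin_cases i <;> simp [latticePoint] <;> ring

theorem rotate_one_latticePoint (a b : ℤ) :
    rotate 1 (latticePoint a b) = latticePoint (a + b) (-a) := by
  have h3 : √3 * √3 = 3 := Real.mul_self_sqrt (by norm_num)
  ext i
  fin_cases i
  · simp [latticePoint, rotate, rotationMatrix]
    linear_combination (b : ℝ) / 4 * h3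
  · simp [latticePoint, rotate, rotationMatrix]
    ring

theorem rotate_neg_one_latticePoint (a b : ℤ) :
    rotate (-1) (latticePoint a b) = latticePoint (-b) (a + b) := by
  have h3 : √3 * √3 = 3 := Real.mul_self_sqrt (by norm_num)
  ext i
  fin_cases i
  · simp [latticePoint, rotate, rotationMatrix]
    linear_combination -(b : ℝ) / 4 * h3
  · simp [latticePoint, rotate, rotationMatrix]
    ring

theorem norm_rotate (z : ℤˣ) (v : Plane) : ‖rotate z v‖ = ‖v‖ := by
  rw [EuclideanSpace.norm_eq, EuclideanSpace.norm_eq]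
  congr 1
  simp only [rotate, rotationMatrix, Matrix.mulVec, dotProduct, Fin.sum_univ_two,
    Real.norm_eq_abs, sq_abs]
  simp
  linear_combination (v 0 ^ 2 + v 1 ^ 2) *
    Real.sin_sq_add_cos_sq (Real.pi / 3 * ((z : ℤ) : ℝ))

theorem add_rotate_mem (z : ℤˣ) (x v : Plane) (hx : x ∈ honeycomb) (hv : x + v ∈ honeycomb) :
    x + v + rotate z v ∈ honeycomb := by
  obtain ⟨m, n, hmn, rfl⟩ := hx
  obtain ⟨m', n', -, h⟩ := hv
  have hv' : v = latticePoint (m' - m) (n' - n) := by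
    rw [← latticePoint_sub, ← h]; abel
  rw [h, hv']
  rw [Int.ModEq] at hmn
  rcases Int.units_eq_one_or z with rfl | rfl
  · rw [rotate_one_latticePoint, latticePoint_add]
    refine ⟨_, _, ?_, rfl⟩
    rw [Int.ModEq]
    omega
  · rw [rotate_neg_one_latticePoint, latticePoint_add]
    refine ⟨_, _, ?_, rfl⟩
    rw [Int.ModEq]
    omega

open Classical in
/-- The equations of motion: `r(t+1) = r(t) + v(t)`, `v(t+1) = R[C(t, r(t+1))] v(t)`, and the
scatterer at `r(t+1)` flips its orientation. -/
noncomputable def State.step (s : State) : State where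
  pos := ⟨s.pos + s.vel, s.mem⟩
  vel := rotate (s.conf ⟨s.pos + s.vel, s.mem⟩) s.vel
  conf := fun h => if (h : Plane) = s.pos + s.vel then -s.conf h else s.conf h
  norm_vel := by rw [norm_rotate, s.norm_vel]
  mem := add_rotate_mem _ _ _ s.pos.2 s.mem

/-- The particle moves along a bond of the lattice in each time step. -/
theorem State.adj_step (s : State) : honeycombGraph.Adj s.pos s.step.pos := by
  change dist (s.pos : Plane) (s.pos + s.vel) = 1
  rw [dist_self_add_right, s.norm_vel]

/-- The trajectory `t ↦ r(t)` of the particle for a given initial condition. -/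
noncomputable def trajectory (I : State) (t : ℕ) : Site := (State.step^[t] I).pos

/-- A trajectory is periodic if it repeats from time zero on, with some positive period. -/
def IsPeriodic (r : ℕ → Site) : Prop := ∃ T : ℕ, 0 < T ∧ ∀ t : ℕ, r t = r (t + T)

theorem zero_mem_honeycomb : (0 : Plane) ∈ honeycomb := by
  refine ⟨0, 0, by decide, ?_⟩
  ext i
  fin_cases i <;> simp [latticePoint]

theorem one_mem_honeycomb : (0 : Plane) + !₂[1, 0] ∈ honeycomb := by
  refine ⟨1, 0, by decide, ?_⟩
  ext i
  fin_cases i <;> simp [latticePoint]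

/-- The initial condition with `r(0) = (0, 0)`, `v(0) = (1, 0)` and initial configuration `C`. -/
noncomputable def initialCondition (C : Configuration) : State where
  pos := ⟨0, zero_mem_honeycomb⟩
  vel := !₂[1, 0]
  conf := C
  norm_vel := by simp [EuclideanSpace.norm_eq, Fin.sum_univ_two]
  mem := one_mem_honeycomb

/-- Every set of orientations is measurable. -/
theorem measurableSet_orientation (s : Set ℤˣ) : MeasurableSet s :=
  ⟨(fun u : ℤˣ => (u : ℤ)) '' s, MeasurableSet.of_discrete,
    Set.preimage_image_eq s Units.val_injective⟩

/-- The random initial configuration of the `(H; p)` model: the orientations `C h` of the scatterers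
are independent random variables, and each scatterer is a right scatterer with probability `p`. -/
structure IsRandomConfiguration {Ω : Type*} [MeasurableSpace Ω] (P : MeasureTheory.Measure Ω)
    (p : ℝ) (C : Site → Ω → ℤˣ) : Prop where
  measurable : ∀ h, Measurable (C h)
  indep : ProbabilityTheory.iIndepFun C P
  prob_right : ∀ h, P {ω | C h ω = 1} = ENNReal.ofReal p

end FlippingRotator

/-! The motion is reversible: since each scatterer flips when it is passed, a particle turned round
on its bond undoes all its turns and flips (`move_iterate_rev`). Suppose the particle leaves a half
plane and meets a finite structure on the other side that sends it back along the same bond. It then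
retraces its path to the initial bond, with opposite velocity, and the only net change is a set δ of
flips inside the structure (`bounce`). Now follow the reversed particle from the initial bond. If it
never leaves the half plane, the trajectory is bounded in that direction. If it leaves from another
site and meets a second structure, disjoint from the first, it comes back as well; repeating both
reflections cancels all flips, as δ² = 1, and the initial state recurs. If it leaves from the same
site, one structure suffices. Two explicit reflectors, one above and one below the line of approach,
cover all cases (`bddAbove_of_confinement`).

The exit sites depend only on the scatterers in the half plane, whereas the reflectors lie in the
strip just beyond it. Hence the required structures, at most 40 scatterers, are present with
conditional probability at least ε^40, where ε bounds the probability of either orientation from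
below (`IsRandomField.measure_inter_escapeEvent_le`). Over infinitely many successive strips the
particle almost surely fails to escape, so its first Cartesian coordinate is bounded above
(`IsRandomField.ae_bddAbove`).

Rotating by 2π/3 gives such bounds in three directions whose vectors sum to zero, so the trajectory
is bounded. Only finitely many states are then possible, and injectivity of the motion turns a
repeated state into a return to the initial one (`exists_return_of_finite_range`). -/

namespace FlippingRotator

/-! ### Reversible motion in lattice coordinates -/

/-- Coordinates with respect to the basis `(1, 0)`, `(1/2, √3/2)` of the triangular lattice. -/
abbrev Coord : Type := ℤ × ℤ

/-- The state of the particle in lattice coordinates: position, velocity, configuration. -/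
abbrev CState : Type := Coord × Coord × (Coord → ℤˣ)

/-- Rotation by `π/3`, to the right if `z = 1` and to the left if `z = -1`. -/
def turn (z : ℤˣ) (v : Coord) : Coord :=
  if z = 1 then (v.1 + v.2, -v.1) else (-v.2, v.1 + v.2)

/-- The site that the particle reaches next. -/
def target (s : CState) : Coord := s.1 + s.2.1

/-- The equations of motion in lattice coordinates. -/
def move (s : CState) : CState :=
  (target s, turn (s.2.2 (target s)) s.2.1,
    Function.update s.2.2 (target s) (-s.2.2 (target s)))

/-- The particle on the same bond, moving in the opposite direction. -/
def rev (s : CState) : CState := (target s, -s.2.1, s.2.2)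

theorem target_rev (s : CState) : target (rev s) = s.1 := by
  simp [target, rev]

theorem rev_rev (s : CState) : rev (rev s) = s := by
  ext1
  · exact target_rev s
  · simp [rev]

theorem turn_neg_turn (z : ℤˣ) (v : Coord) : turn (-z) (-turn z v) = -v := by
  rcases Int.units_eq_one_or z with rfl | rfl <;> ext <;> simp [turn]

/-- The reversed particle first meets the scatterer it has just flipped, which now turns it by the
opposite angle and is flipped back. -/
theorem move_rev_move (s : CState) : move (rev (move s)) = rev s := by
  have h : target (rev (move s)) = target s := target_rev _
  unfold move
  rw [show move s = (target s, turn (s.2.2 (target s)) s.2.1,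
    Function.update s.2.2 (target s) (-s.2.2 (target s))) from rfl] at h
  rw [h]
  simp [rev, turn_neg_turn]

theorem move_iterate_rev (t : ℕ) (s : CState) : move^[t] (rev (move^[t] s)) = rev s := by
  induction t with
  | zero => rfl
  | succ t ih =>
    rw [Function.iterate_succ_apply' move t s, Function.iterate_succ_apply, move_rev_move, ih]

theorem move_injective : Function.Injective move := by
  intro s s' h
  have := move_rev_move s
  rw [h, move_rev_move] at this
  rw [← rev_rev s, ← this, rev_rev]

/-- As long as a particle only meets scatterers in `S`, its motion is carried over by `A` and a
translation to any configuration that looks the same on the image of `S`. -/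
theorem move_iterate_map {A : Coord →+ Coord} (hA : Function.Injective A)
    (hturn : ∀ z v, turn z (A v) = A (turn z v)) (e : Coord) {S : Set Coord} {s s' : CState}
    (h1 : s'.1 = e + A s.1) (h2 : s'.2.1 = A s.2.1) (h3 : ∀ q ∈ S, s'.2.2 (e + A q) = s.2.2 q)
    {T : ℕ} (hT : ∀ t < T, target (move^[t] s) ∈ S) :
    (move^[T] s').1 = e + A (move^[T] s).1 ∧ (move^[T] s').2.1 = A (move^[T] s).2.1 ∧
      (∀ q ∈ S, (move^[T] s').2.2 (e + A q) = (move^[T] s).2.2 q) ∧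
      ∀ q, (∀ r ∈ S, q ≠ e + A r) → (move^[T] s').2.2 q = s'.2.2 q := by
  induction T with
  | zero => exact ⟨h1, h2, h3, fun _ _ => rfl⟩
  | succ T ih =>
    obtain ⟨i1, i2, i3, i4⟩ := ih fun t ht => hT t (by omega)
    have hS := hT T (by omega)
    simp only [Function.iterate_succ_apply']
    generalize move^[T] s = a at *
    generalize move^[T] s' = b at *
    have ht : target b = e + A (target a) := by
      simp [target, i1, i2, add_assoc]
    refine ⟨ht, ?_, ?_, ?_⟩
    · simp only [move, ht, i2, i3 _ hS, hturn]
    · intro q hq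
      simp only [move, ht, i3 _ hS]
      by_cases hqa : q = target a
      · simp [hqa]
      · rw [Function.update_of_ne hqa, Function.update_of_ne, i3 q hq]
        exact fun h => hqa (hA (add_left_cancel h))
    · intro q hq
      simp only [move, ht]
      rw [Function.update_of_ne (hq _ hS), i4 q hq]

/-- The motion only depends on the scatterers that the particle meets. -/
theorem move_iterate_congr {S : Set Coord} {x v : Coord} {c c' : Coord → ℤˣ}
    (hc : Set.EqOn c' c S) {T : ℕ} (hT : ∀ t < T, target (move^[t] (x, v, c)) ∈ S) :
    (move^[T] (x, v, c')).1 = (move^[T] (x, v, c)).1 ∧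
      (move^[T] (x, v, c')).2.1 = (move^[T] (x, v, c)).2.1 ∧
      Set.EqOn (move^[T] (x, v, c')).2.2 (move^[T] (x, v, c)).2.2 S ∧
      Set.EqOn (move^[T] (x, v, c')).2.2 c' Sᶜ := by
  have := move_iterate_map (A := AddMonoidHom.id Coord) (fun _ _ h => h) (fun _ _ => rfl) 0
    (s := (x, v, c)) (s' := (x, v, c')) (by simp) (by simp)
    (fun q hq => by simpa using hc hq) hT
  simp only [AddMonoidHom.id_apply, zero_add] at this
  refine ⟨this.1, this.2.1, this.2.2.1, fun q hq => this.2.2.2 q ?_⟩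
  rintro r hr rfl
  exact hq hr

theorem target_congr {S : Set Coord} {x v : Coord} {c c' : Coord → ℤˣ}
    (hc : Set.EqOn c' c S) {T : ℕ} (hT : ∀ t < T, target (move^[t] (x, v, c)) ∈ S) :
    target (move^[T] (x, v, c')) = target (move^[T] (x, v, c)) := by
  obtain ⟨h1, h2, -⟩ := move_iterate_congr hc hT
  rw [target, target, h1, h2]

theorem rev_mk (x v : Coord) (c : Coord → ℤˣ) : rev (x, v, c) = (x + v, -v, c) := rfl

/-- If the particle, leaving a region through a bond, is reflected on the outside, then it retraces
its path, and only the scatterers that reflected it are changed. -/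
theorem bounce {S U : Set Coord} (hSU : Disjoint S U) {x v e w : Coord} {c δ : Coord → ℤˣ}
    (hδ : ∀ q ∉ U, δ q = 1) {L : ℕ}
    (hL : ∀ d, Set.EqOn d c U → move^[L] (e, w, d) = rev (e, w, d * δ)) {T : ℕ}
    (hT : ∀ t < T, target (move^[t] (x, v, c)) ∈ S) (h1 : (move^[T] (x, v, c)).1 = e)
    (h2 : (move^[T] (x, v, c)).2.1 = w) {c' : Coord → ℤˣ} (hc' : Set.EqOn c' c (S ∪ U)) :
    move^[T + (L + T)] (x, v, c') = rev (x, v, c' * δ) := by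
  have hδS : ∀ q ∈ S, δ q = 1 := fun q hq => hδ q (Set.disjoint_left.1 hSU hq)
  obtain ⟨a1, a2, a3, a4⟩ := move_iterate_congr (hc'.mono Set.subset_union_left) hT
  have hcδ : Set.EqOn (c' * δ) c S := fun q hq => by
    rw [Pi.mul_apply, hδS q hq, mul_one, hc' (Or.inl hq)]
  obtain ⟨b1, b2, b3, b4⟩ := move_iterate_congr hcδ hT
  set d := (move^[T] (x, v, c')).2.2
  have e1 : move^[T] (x, v, c') = (e, w, d) :=
    Prod.ext (a1.trans h1) (Prod.ext (a2.trans h2) rfl)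
  -- The flips in `δ` lie off `S`, so the same path can be run on `c' * δ`. The state after
  -- reflection is the reversal of its endpoint, so `move_iterate_rev` applies.
  have e2 : move^[T] (x, v, c' * δ) = (e, w, d * δ) := by
    refine Prod.ext (b1.trans h1) (Prod.ext (b2.trans h2) (funext fun q => ?_))
    by_cases hq : q ∈ S
    · change _ = d q * δ q
      rw [b3 hq, hδS q hq, mul_one, a3 hq]
    · change _ = d q * δ q
      rw [b4 hq, Pi.mul_apply, a4 hq]
  have hd : Set.EqOn d c U := fun q hq => by
    rw [a4 (Set.disjoint_right.1 hSU hq), hc' (Or.inr hq)]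
  rw [add_comm T, Function.iterate_add_apply, e1, add_comm L, Function.iterate_add_apply, hL d hd,
    ← e2, move_iterate_rev]

theorem mul_mul_self_conf (c δ : Coord → ℤˣ) : c * δ * δ = c := by
  ext1 q
  rw [Pi.mul_apply, Pi.mul_apply, mul_assoc, Int.units_mul_self, mul_one]

/-- The reflection of the particle reverses the change of the configuration when it is repeated. -/
theorem bounce_symm {V : Set Coord} {x v : Coord} {c δ : Coord → ℤˣ} {N : ℕ}
    (h : ∀ c', Set.EqOn c' c V → move^[N] (x, v, c') = rev (x, v, c' * δ)) {c' : Coord → ℤˣ}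
    (hc' : Set.EqOn c' (c * δ) V) : move^[N] (x, v, c') = rev (x, v, c' * δ) := by
  have h1 := h (c' * δ) fun q hq => by
    rw [Pi.mul_apply, hc' hq]
    exact congrFun (mul_mul_self_conf c δ) q
  -- The bounce is known for `c' * δ`, which agrees with `c` on `V`; reversing that motion in time
  -- gives the bounce for `c'`.
  have h2 := move_iterate_rev N (x, v, c' * δ)
  rwa [h1, rev_rev, mul_mul_self_conf] at h2

/-- The position stays in a finite region if the state returns. -/
theorem finite_range_of_return {s : CState} {N : ℕ} (hN : 0 < N) (h : move^[N] s = s) :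
    (Set.range fun t => (move^[t] s).1).Finite := by
  refine (Set.finite_range fun t : Fin N => (move^[t] s).1).subset ?_
  rintro _ ⟨t, rfl⟩
  refine ⟨⟨t % N, Nat.mod_lt _ hN⟩, ?_⟩
  change (move^[t % N] s).1 = (move^[t] s).1
  rw [Function.IsPeriodicPt.iterate_mod_apply h]

/-! ### The two reflectors -/

/-- The sites and orientations of a reflecting structure for a particle that comes from the origin
in direction `(1, 0)`. It lies in the upper half plane. -/
def upperReflector : List (Coord × ℤˣ) :=
  [((1, 0), -1), ((1, 1), 1), ((2, 1), -1), ((2, 2), -1), ((1, 3), -1), ((0, 3), 1), ((-1,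
    4), 1), ((-1, 5), 1), ((0, 5), -1), ((0, 6), 1), ((1, 6), 1), ((2, 5), 1), ((2, 4), -1),
    ((3, 3), -1), ((4, 3), 1), ((5, 2), 1), ((5, 1), 1), ((4, 1), 1), ((3, 2), -1), ((1, 4),
    1)]

/-- The sites and orientations of a reflecting structure for a particle that comes from the origin
in direction `(1, 0)`. It lies in the lower half plane. -/
def lowerReflector : List (Coord × ℤˣ) :=
  [((1, 0), 1), ((2, -1), -1), ((3, -1), 1), ((4, -2), -1), ((5, -2), -1), ((5, -1), 1), ((6,
    -1), 1), ((7, -2), 1), ((7, -3), -1), ((8, -4), 1), ((8, -5), 1), ((7, -5), 1), ((6, -4),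
    -1), ((5, -4), -1), ((5, -5), 1), ((4, -5), 1), ((3, -4), 1), ((3, -3), 1), ((4, -3), -1),
    ((6, -3), 1)]

/-- The configuration with the given orientations, all other scatterers being right scatterers. -/
def confOfList (l : List (Coord × ℤˣ)) (q : Coord) : ℤˣ := (l.lookup q).getD 1

/-- The particle only meets scatterers at the sites of `K` during the next `n` time steps. -/
def staysIn (K : List Coord) : ℕ → CState → Bool
  | 0, _ => true
  | n + 1, s => K.elem (target s) && staysIn K n (move s)

/-- A finite computation. The default orientation used by `confOfList` off the list plays no role,
because the particle meets only listed sites. -/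
theorem upperReflector_spec :
    staysIn (upperReflector.map Prod.fst) 29 ((0, 0), (1, 0), confOfList upperReflector) = true ∧
      (move^[29] ((0, 0), (1, 0), confOfList upperReflector)).1 = (1, 0) ∧
      (move^[29] ((0, 0), (1, 0), confOfList upperReflector)).2.1 = (-1, 0) := by
  decide +kernel

theorem lowerReflector_spec :
    staysIn (lowerReflector.map Prod.fst) 29 ((0, 0), (1, 0), confOfList lowerReflector) = true ∧
      (move^[29] ((0, 0), (1, 0), confOfList lowerReflector)).1 = (1, 0) ∧
      (move^[29] ((0, 0), (1, 0), confOfList lowerReflector)).2.1 = (-1, 0) := by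
  decide +kernel

/-- The height of a site, in the direction `(1, 0)`. -/
def height (q : Coord) : ℤ := 2 * q.1 + q.2

/-- The structure `l` sends back a particle that comes from the origin in direction `(1, 0)`. -/
structure IsReflector (l : List (Coord × ℤˣ)) (N : ℕ) : Prop where
  pos : 0 < N
  stays : staysIn (l.map Prod.fst) N ((0, 0), (1, 0), confOfList l) = true
  fst : (move^[N] ((0, 0), (1, 0), confOfList l)).1 = (1, 0)
  snd : (move^[N] ((0, 0), (1, 0), confOfList l)).2.1 = (-1, 0)
  height_mem : ∀ a ∈ l, 0 < height a.1 ∧ height a.1 ≤ 12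
  site : ∀ a ∈ l, (a.1.1 - a.1.2) % 3 ≠ 2
  nodup : (l.map Prod.fst).Nodup
  length : l.length = 20

theorem isReflector_upper : IsReflector upperReflector 29 where
  pos := by norm_num
  stays := upperReflector_spec.1
  fst := upperReflector_spec.2.1
  snd := upperReflector_spec.2.2
  height_mem := by decide +kernel
  site := by decide +kernel
  nodup := by decide +kernel
  length := rfl

theorem isReflector_lower : IsReflector lowerReflector 29 where
  pos := by norm_num
  stays := lowerReflector_spec.1
  fst := lowerReflector_spec.2.1
  snd := lowerReflector_spec.2.2
  height_mem := by decide +kernel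
  site := by decide +kernel
  nodup := by decide +kernel
  length := rfl

/-- The configuration `c` has the orientations given by `l`. -/
def Matches (c : Coord → ℤˣ) (l : List (Coord × ℤˣ)) : Prop := ∀ a ∈ l, c a.1 = a.2

/-- The sites of the structure `l`. -/
def sites (l : List (Coord × ℤˣ)) : Set Coord := {q | q ∈ l.map Prod.fst}

/-- The structure `l`, translated by `e`. -/
def shift (e : Coord) (l : List (Coord × ℤˣ)) : List (Coord × ℤˣ) :=
  l.map fun a => (e + a.1, a.2)

theorem mem_sites_shift {e q : Coord} {l : List (Coord × ℤˣ)} :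
    q ∈ sites (shift e l) ↔ ∃ r ∈ sites l, q = e + r := by
  simp only [sites, shift, List.map_map, Set.mem_ofPred_eq, List.mem_map, Function.comp]
  constructor
  · rintro ⟨a, ha, rfl⟩
    exact ⟨a.1, ⟨a, ha, rfl⟩, rfl⟩
  · rintro ⟨_, ⟨a, ha, rfl⟩, rfl⟩
    exact ⟨a, ha, rfl⟩

theorem mem_of_mem_sites {q : Coord} {l : List (Coord × ℤˣ)} (hq : q ∈ sites l) :
    (q, confOfList l q) ∈ l := by
  induction l with
  | nil => simp [sites] at hq
  | cons a l ih =>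
    obtain ⟨a1, a2⟩ := a
    by_cases h : q = a1
    · subst h
      simp [confOfList]
    · have hq' : q ∈ sites l := by
        simpa [sites, h] using hq
      have hb : (q == a1) = false := by simpa using h
      have : confOfList ((a1, a2) :: l) q = confOfList l q := by
        simp only [confOfList, List.lookup, hb]
      rw [this]
      exact List.mem_cons_of_mem _ (ih hq')

theorem Matches.congr {c c' : Coord → ℤˣ} {l : List (Coord × ℤˣ)} (h : Matches c l)
    (hc : Set.EqOn c' c (sites l)) : Matches c' l := fun a ha => by
  rw [hc (List.mem_map_of_mem ha), h a ha]

theorem staysIn_iterate {K : List Coord} {n : ℕ} {s : CState} (h : staysIn K n s = true) {t : ℕ}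
    (ht : t < n) : target (move^[t] s) ∈ K := by
  induction n generalizing s t with
  | zero => omega
  | succ n ih =>
    simp only [staysIn, Bool.and_eq_true, List.elem_eq_mem, decide_eq_true_eq] at h
    cases t with
    | zero => exact h.1
    | succ t => exact ih h.2 (by omega)

/-- The flips `δ` are read off from the run at the origin, as the product of the initial and final
orientations. They depend on `l` and `e` but not on the surrounding configuration, which is what
lets a second reflection cancel them. -/
theorem IsReflector.exists_reflection {l : List (Coord × ℤˣ)} {N : ℕ} (hl : IsReflector l N)
    (e : Coord) : ∃ δ : Coord → ℤˣ, (∀ q ∉ sites (shift e l), δ q = 1) ∧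
      ∀ c, Matches c (shift e l) → move^[N] (e, (1, 0), c) = rev (e, (1, 0), c * δ) := by
  classical
  set fin := (move^[N] ((0, 0), (1, 0), confOfList l)).2.2 with hfin
  refine ⟨fun q => if q ∈ sites (shift e l) then confOfList l (q - e) * fin (q - e) else 1,
    fun q hq => if_neg hq, fun c hc => ?_⟩
  have hconf : ∀ q ∈ sites l, c (e + q) = confOfList l q := fun q hq =>
    hc _ (List.mem_map_of_mem (mem_of_mem_sites hq))
  obtain ⟨h1, h2, h3, h4⟩ := move_iterate_map (A := AddMonoidHom.id Coord) (fun _ _ h => h)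
    (fun _ _ => rfl) e (S := sites l) (s := ((0, 0), (1, 0), confOfList l))
    (s' := (e, (1, 0), c)) (by simp) rfl hconf (T := N) fun t ht => staysIn_iterate hl.stays ht
  rw [hl.fst] at h1
  rw [hl.snd] at h2
  refine Prod.ext h1 (Prod.ext (h2.trans (by simp [rev])) (funext fun q => ?_))
  change _ = c q * ite _ _ _
  by_cases hq : q ∈ sites (shift e l)
  · rw [if_pos hq]
    obtain ⟨r, hr, rfl⟩ := mem_sites_shift.1 hq
    rw [add_sub_cancel_left, hconf r hr, ← mul_assoc, Int.units_mul_self, one_mul]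
    exact h3 r hr
  · rw [if_neg hq, mul_one]
    exact h4 q fun r hr h => hq (mem_sites_shift.2 ⟨r, hr, h⟩)

/-! ### Half planes and exits -/

/-- The half plane `2 m + n ≤ 12 k`. -/
def region (k : ℕ) : Set Coord := {q | height q ≤ 12 * k}

/-- At the point `x` of the triangular lattice, the velocity `v` points along a bond. -/
def IsBond (x v : Coord) : Prop :=
  (x.1 - x.2) % 3 = 0 ∧ (v = (1, 0) ∨ v = (-1, 1) ∨ v = (0, -1)) ∨
    (x.1 - x.2) % 3 = 1 ∧ (v = (-1, 0) ∨ v = (1, -1) ∨ v = (0, 1))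

theorem IsBond.reverse {x v : Coord} (h : IsBond x v) : IsBond (x + v) (-v) := by
  obtain ⟨m, n⟩ := x
  rcases h with ⟨h, rfl | rfl | rfl⟩ | ⟨h, rfl | rfl | rfl⟩ <;> simp only [IsBond] at h ⊢ <;>
    simp <;> omega

theorem IsBond.scatter {x v : Coord} (h : IsBond x v) (z : ℤˣ) : IsBond (x + v) (turn z v) := by
  obtain ⟨m, n⟩ := x
  rcases Int.units_eq_one_or z with rfl | rfl <;>
  rcases h with ⟨h, rfl | rfl | rfl⟩ | ⟨h, rfl | rfl | rfl⟩ <;> simp only [IsBond] at h ⊢ <;>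
    simp [turn] <;> omega

theorem IsBond.iterate {s : CState} (h : IsBond s.1 s.2.1) (t : ℕ) :
    IsBond (move^[t] s).1 (move^[t] s).2.1 := by
  induction t with
  | zero => exact h
  | succ t ih =>
    rw [Function.iterate_succ_apply']
    exact ih.scatter _

/-- Sites have height 0 or 2 modulo 3, and 12 is a multiple of 3. A bond that raises the height by 1
ends at a multiple of 3, so it cannot start at or below the boundary and end above it; only bonds in
direction `(1, 0)` cross. -/
theorem IsBond.eq_of_cross {x v : Coord} (h : IsBond x v) {k : ℕ} (hx : x ∈ region k)
    (hv : x + v ∉ region k) : v = (1, 0) ∧ height x = 12 * k ∧ (x.1 - x.2) % 3 = 0 := by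
  obtain ⟨m, n⟩ := x
  rcases h with ⟨h, rfl | rfl | rfl⟩ | ⟨h, rfl | rfl | rfl⟩ <;>
    simp [region, height] at h hx hv ⊢ <;> omega

/-- The particle leaves `S` from the site `e`. -/
def Leaves (S : Set Coord) (x v : Coord) (c : Coord → ℤˣ) (e : Coord) : Prop :=
  ∃ T, (∀ t < T, target (move^[t] (x, v, c)) ∈ S) ∧ target (move^[T] (x, v, c)) ∉ S ∧
    (move^[T] (x, v, c)).1 = e

theorem pos_mem_of_target_mem {S : Set Coord} {s : CState} (hx : s.1 ∈ S) {T : ℕ}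
    (hT : ∀ t < T, target (move^[t] s) ∈ S) : (move^[T] s).1 ∈ S := by
  cases T with
  | zero => exact hx
  | succ T =>
    rw [Function.iterate_succ_apply']
    exact hT T (by omega)

theorem Leaves.cross {k : ℕ} {x v e : Coord} {c : Coord → ℤˣ} (h : Leaves (region k) x v c e)
    (hb : IsBond x v) (hx : x ∈ region k) : height e = 12 * k ∧ (e.1 - e.2) % 3 = 0 := by
  obtain ⟨T, hT, hT', rfl⟩ := h
  exact (IsBond.eq_of_cross (IsBond.iterate (s := (x, v, c)) hb T)
    (pos_mem_of_target_mem (s := (x, v, c)) hx hT) hT').2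

theorem IsReflector.disjoint {l : List (Coord × ℤˣ)} {N : ℕ} (hl : IsReflector l N) {k : ℕ}
    {e : Coord} (he : height e = 12 * k) : Disjoint (region k) (sites (shift e l)) := by
  rw [Set.disjoint_right]
  intro q hq hq'
  obtain ⟨r, hr, rfl⟩ := mem_sites_shift.1 hq
  have := hl.height_mem _ (mem_of_mem_sites hr)
  simp [region, height] at *
  omega

/-- The lower reflector has second coordinates at most 0 and the upper one at least 0, relative to
their exit sites, so a lower one placed below an upper one cannot overlap it. -/
theorem disjoint_lower_upper {e e' : Coord} (h : e.2 < e'.2) :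
    Disjoint (sites (shift e lowerReflector)) (sites (shift e' upperReflector)) := by
  rw [Set.disjoint_left]
  intro q hq hq'
  obtain ⟨r, hr, rfl⟩ := mem_sites_shift.1 hq
  obtain ⟨r', hr', hrr⟩ := mem_sites_shift.1 hq'
  have h1 : ∀ a ∈ lowerReflector, a.1.2 ≤ 0 := by decide +kernel
  have h2 : ∀ a ∈ upperReflector, 0 ≤ a.1.2 := by decide +kernel
  have h1 := h1 _ (mem_of_mem_sites hr)
  have h2 := h2 _ (mem_of_mem_sites hr')
  have := congrArg Prod.snd hrr
  simp at *
  omega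

/-! ### Confinement by reflectors -/

/-- A particle that leaves a half plane towards a reflector retraces its path. -/
theorem Leaves.exists_bounce {l : List (Coord × ℤˣ)} {N : ℕ} (hl : IsReflector l N) {k : ℕ}
    {x v e : Coord} {c : Coord → ℤˣ} (h : Leaves (region k) x v c e) (hb : IsBond x v)
    (hx : x ∈ region k) (hm : Matches c (shift e l)) {δ : Coord → ℤˣ}
    (hδ : ∀ q ∉ sites (shift e l), δ q = 1)
    (hL : ∀ c, Matches c (shift e l) → move^[N] (e, (1, 0), c) = rev (e, (1, 0), c * δ)) :
    ∃ M, 0 < M ∧ ∀ c', Set.EqOn c' c (region k ∪ sites (shift e l)) →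
      move^[M] (x, v, c') = rev (x, v, c' * δ) := by
  have he := (h.cross hb hx).1
  obtain ⟨T, hT, hT', hTe⟩ := h
  have hv := (IsBond.eq_of_cross (IsBond.iterate (s := (x, v, c)) hb T)
    (pos_mem_of_target_mem (s := (x, v, c)) hx hT) hT').1
  refine ⟨T + (N + T), by have := hl.pos; omega, fun c' hc => ?_⟩
  exact bounce (hl.disjoint he) hδ (fun d hd => hL d (hm.congr hd)) hT hTe hv hc

/-- The structures that confine a particle that leaves a half plane from `e`, if the reversed
particle leaves it from `e'`, or stays in it. -/
def confinement (e : Coord) : Option Coord → List (Coord × ℤˣ)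
  | none => shift e upperReflector
  | some e' =>
    if e' = e then shift e upperReflector
    else if e.2 < e'.2 then shift e lowerReflector ++ shift e' upperReflector
    else shift e upperReflector ++ shift e' lowerReflector

/-- The particle shuttles between the two reflectors. Each round trip flips by `δ * δ'`, so after
four reflections the configuration is restored and the initial state recurs. Disjointness ensures
that neither reflector is disturbed by the flips in the other. -/
theorem finite_range_of_two_reflectors {l l' : List (Coord × ℤˣ)} {N N' : ℕ}
    (hl : IsReflector l N) (hl' : IsReflector l' N') {k : ℕ} {x v e e' : Coord} {c : Coord → ℤˣ}
    (hdis : Disjoint (sites (shift e l)) (sites (shift e' l'))) (hb : IsBond x v)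
    (hx : x ∈ region k) (hxv : x + v ∈ region k) (h : Leaves (region k) x v c e)
    (h' : Leaves (region k) (x + v) (-v) c e') (hm : Matches c (shift e l))
    (hm' : Matches c (shift e' l')) :
    (Set.range fun t => (move^[t] (x, v, c)).1).Finite := by
  obtain ⟨δ, hδ, hL⟩ := hl.exists_reflection e
  obtain ⟨δ', hδ', hL'⟩ := hl'.exists_reflection e'
  obtain ⟨M, hM, hMc⟩ := h.exists_bounce hl hb hx hm hδ hL
  obtain ⟨M', hM', hMc'⟩ := h'.exists_bounce hl' hb.reverse hxv hm' hδ' hL'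
  have hd := Set.disjoint_left.1 (hl.disjoint (h.cross hb hx).1)
  have hd' := Set.disjoint_left.1 (hl'.disjoint (h'.cross hb.reverse hxv).1)
  have hU := Set.disjoint_left.1 hdis
  have hU' := Set.disjoint_right.1 hdis
  have s1 := hMc c fun _ _ => rfl
  have s2 := hMc' (c * δ) fun q hq => by
    rw [Pi.mul_apply, hδ q (hq.elim (fun h => hd h) fun h => hU' h), mul_one]
  have s3 := bounce_symm hMc (c' := c * δ * δ') fun q hq => by
    rw [Pi.mul_apply, hδ' q (hq.elim (fun h => hd' h) fun h => hU h), mul_one]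
  have s4 := bounce_symm hMc' (c' := c * δ * δ' * δ) fun q hq => by
    rw [Pi.mul_apply, Pi.mul_apply, Pi.mul_apply, Pi.mul_apply,
      hδ q (hq.elim (fun h => hd h) fun h => hU' h), mul_one, mul_one]
  have hcc : c * δ * δ' * δ * δ' = c := by
    rw [mul_assoc (c * δ * δ') δ δ', mul_assoc c δ δ', mul_mul_self_conf]
  rw [rev_mk] at s1 s2 s3 s4
  rw [hcc] at s4
  simp only [add_neg_cancel_right, neg_neg] at s2 s4
  refine finite_range_of_return (N := M' + (M + (M' + M))) (by omega) ?_
  rw [Function.iterate_add_apply, Function.iterate_add_apply, Function.iterate_add_apply, s1, s2,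
    s3, s4]

/-- Both ends of the path lead into the same reflector. The second reflection runs on the flipped
configuration, where `bounce_symm` shows that it cancels the first. -/
theorem finite_range_of_one_reflector {l : List (Coord × ℤˣ)} {N : ℕ}
    (hl : IsReflector l N) {k : ℕ} {x v e : Coord} {c : Coord → ℤˣ} (hb : IsBond x v)
    (hx : x ∈ region k) (hxv : x + v ∈ region k) (h : Leaves (region k) x v c e)
    (h' : Leaves (region k) (x + v) (-v) c e) (hm : Matches c (shift e l)) :
    (Set.range fun t => (move^[t] (x, v, c)).1).Finite := by
  obtain ⟨δ, hδ, hL⟩ := hl.exists_reflection e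
  obtain ⟨M, hM, hMc⟩ := h.exists_bounce hl hb hx hm hδ hL
  obtain ⟨M', hM', hMc'⟩ := h'.exists_bounce hl hb.reverse hxv hm hδ hL
  have s1 := hMc c fun _ _ => rfl
  have s2 := bounce_symm hMc' (c' := c * δ) fun _ _ => rfl
  rw [rev_mk] at s1 s2
  rw [mul_mul_self_conf, add_neg_cancel_right, neg_neg] at s2
  refine finite_range_of_return (N := M' + M) (by omega) ?_
  rw [Function.iterate_add_apply, s1, s2]

theorem bddAbove_of_finite_range {s : CState}
    (h : (Set.range fun t => (move^[t] s).1).Finite) :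
    BddAbove (Set.range fun t => height (move^[t] s).1) := by
  have := (h.image height).bddAbove
  rwa [← Set.range_comp] at this

/-- The reversed particle leaves the half plane from the given site, or stays in it. -/
def LeavesOrStays (S : Set Coord) (x v : Coord) (c : Coord → ℤˣ) : Option Coord → Prop
  | none => ∀ t, target (move^[t] (x, v, c)) ∈ S
  | some e => Leaves S x v c e

/-- A particle that meets the confining structures when it leaves a half plane remains bounded in
one direction. -/
theorem bddAbove_of_confinement {k : ℕ} {x v e : Coord} {c : Coord → ℤˣ} (hb : IsBond x v)
    (hx : x ∈ region k) (hxv : x + v ∈ region k) (h : Leaves (region k) x v c e)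
    {o : Option Coord} (h' : LeavesOrStays (region k) (x + v) (-v) c o)
    (hm : Matches c (confinement e o)) :
    BddAbove (Set.range fun t => height (move^[t] (x, v, c)).1) := by
  have matches_append {c : Coord → ℤˣ} {l l' : List (Coord × ℤˣ)} (h : Matches c (l ++ l')) :
      Matches c l ∧ Matches c l' :=
    ⟨fun a ha => h a (List.mem_append_left _ ha), fun a ha => h a (List.mem_append_right _ ha)⟩
  cases o with
  | none =>
    obtain ⟨δ, hδ, hL⟩ := isReflector_upper.exists_reflection e
    obtain ⟨M, hM, hMc⟩ := h.exists_bounce isReflector_upper hb hx hm hδ hL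
    have s1 := hMc c fun _ _ => rfl
    have hd := Set.disjoint_left.1 (isReflector_upper.disjoint (h.cross hb hx).1)
    -- After the bounce the reversed particle sees only scatterers in the half plane, where `δ`
    -- changes nothing, so it stays there as it would in `c`.
    have hstay (t : ℕ) : (move^[t] (rev (x, v, c * δ))).1 ∈ region k := by
      refine pos_mem_of_target_mem (s := rev (x, v, c * δ)) hxv fun t _ => ?_
      rw [rev_mk, target_congr (c := c) (S := region k) _ fun t _ => h' t]
      · exact h' t
      · intro q hq
        rw [Pi.mul_apply, hδ q (hd hq), mul_one]
    obtain ⟨B, hB⟩ := ((Set.finite_range fun t : Fin M =>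
      height (move^[t] (x, v, c)).1)).bddAbove
    refine ⟨max B (12 * k), ?_⟩
    rintro _ ⟨t, rfl⟩
    rcases lt_or_ge t M with ht | ht
    · exact le_max_of_le_left (hB ⟨⟨t, ht⟩, rfl⟩)
    · obtain ⟨u, rfl⟩ := Nat.exists_eq_add_of_le' ht
      refine le_max_of_le_right ?_
      simp only [Function.iterate_add_apply, s1]
      exact hstay u
  | some e' =>
    apply bddAbove_of_finite_range
    rw [confinement] at hm
    split_ifs at hm with h1 h2
    · subst h1
      exact finite_range_of_one_reflector isReflector_upper hb hx hxv h h' hm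
    · exact finite_range_of_two_reflectors isReflector_lower isReflector_upper
        (disjoint_lower_upper h2) hb hx hxv h h' (matches_append hm).1 (matches_append hm).2
    · have hh := (h.cross hb hx).1
      have hh' := (Leaves.cross h' hb.reverse hxv).1
      -- Both exit sites have height `12 * k`, so equal second coordinates would make them equal.
      have h3 : e'.2 < e.2 := by
        by_contra h3
        refine h1 (Prod.ext ?_ ?_) <;> simp only [height] at hh hh' <;> omega
      exact finite_range_of_two_reflectors isReflector_upper isReflector_lower
        (disjoint_lower_upper h3).symm hb hx hxv h h' (matches_append hm).1 (matches_append hm).2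

/-! ### Measurable events and the scatterers that determine them -/

open MeasureTheory ProbabilityTheory

open scoped ENNReal

instance : DiscreteMeasurableSpace ℤˣ := ⟨measurableSet_orientation⟩

theorem measurable_conf_apply : Measurable fun a : Coord × (Coord → ℤˣ) => a.2 a.1 :=
  measurable_from_prod_countable_right fun q => measurable_pi_apply q

theorem measurable_move : Measurable move := by
  have ht : Measurable target := measurable_fst.add measurable_snd.fst
  have hc : Measurable fun s : CState => s.2.2 (target s) :=
    measurable_conf_apply.comp (ht.prodMk measurable_snd.snd)
  have hturn : Measurable fun a : ℤˣ × Coord => turn a.1 a.2 := .of_discrete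
  refine ht.prodMk ((hturn.comp (hc.prodMk measurable_snd.fst)).prodMk ?_)
  refine measurable_pi_iff.2 fun q => ?_
  simp only [Function.update_apply]
  refine Measurable.ite ?_ ?_ ?_
  · convert ht (MeasurableSet.singleton q) using 1
    ext s
    exact eq_comm
  · exact (Measurable.of_discrete (f := fun z : ℤˣ => -z)).comp hc
  · exact (measurable_pi_apply q).comp measurable_snd.snd

theorem measurable_move_iterate (x v : Coord) (t : ℕ) :
    Measurable fun c : Coord → ℤˣ => move^[t] (x, v, c) :=
  (measurable_move.iterate t).comp (measurable_const.prodMk (measurable_const.prodMk measurable_id))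

theorem measurableSet_target_mem (S : Set Coord) (x v : Coord) (t : ℕ) :
    MeasurableSet {c : Coord → ℤˣ | target (move^[t] (x, v, c)) ∈ S} :=
  ((measurable_fst.add measurable_snd.fst : Measurable target).comp
    (measurable_move_iterate x v t)) (MeasurableSet.of_discrete (s := S))

theorem measurableSet_leaves (S : Set Coord) (x v e : Coord) :
    MeasurableSet {c : Coord → ℤˣ | Leaves S x v c e} := by
  have : {c : Coord → ℤˣ | Leaves S x v c e} = ⋃ T : ℕ,
      (⋂ t : ℕ, ⋂ _ : t < T, {c : Coord → ℤˣ | target (move^[t] (x, v, c)) ∈ S}) ∩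
        ({c : Coord → ℤˣ | target (move^[T] (x, v, c)) ∈ Sᶜ} ∩
        {c : Coord → ℤˣ | (move^[T] (x, v, c)).1 ∈ ({e} : Set Coord)}) := by
    ext c
    simp [Leaves]
  rw [this]
  refine MeasurableSet.iUnion fun T => .inter ?_ (.inter (measurableSet_target_mem _ _ _ _) ?_)
  · exact MeasurableSet.iInter fun t => .iInter fun _ => measurableSet_target_mem _ _ _ _
  · exact (measurable_fst.comp (measurable_move_iterate x v T)) (MeasurableSet.singleton e)

theorem measurableSet_leavesOrStays (S : Set Coord) (x v : Coord) (o : Option Coord) :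
    MeasurableSet {c : Coord → ℤˣ | LeavesOrStays S x v c o} := by
  cases o with
  | some e => exact measurableSet_leaves S x v e
  | none =>
    have : {c : Coord → ℤˣ | LeavesOrStays S x v c none} =
        ⋂ t : ℕ, {c : Coord → ℤˣ | target (move^[t] (x, v, c)) ∈ S} := by
      ext c
      simp [LeavesOrStays]
    rw [this]
    exact MeasurableSet.iInter fun t => measurableSet_target_mem _ _ _ _

theorem measurableSet_matches (l : List (Coord × ℤˣ)) :
    MeasurableSet {c : Coord → ℤˣ | Matches c l} := by
  have : {c : Coord → ℤˣ | Matches c l} =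
      ⋂ a : Coord × ℤˣ, ⋂ _ : a ∈ l, {c : Coord → ℤˣ | c a.1 ∈ ({a.2} : Set ℤˣ)} := by
    ext c
    simp [Matches]
  rw [this]
  exact MeasurableSet.iInter fun a => .iInter fun _ =>
    measurable_pi_apply a.1 (MeasurableSet.singleton a.2)

/-- The event `A` only depends on the scatterers in `S`. -/
def Determined (S : Set Coord) (A : Set (Coord → ℤˣ)) : Prop :=
  ∀ ⦃c c'⦄, Set.EqOn c' c S → c ∈ A → c' ∈ A

theorem Determined.mono {S S' : Set Coord} {A : Set (Coord → ℤˣ)} (h : Determined S A)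
    (hS : S ⊆ S') : Determined S' A := fun _ _ hc => h (hc.mono hS)

theorem Determined.inter {S : Set Coord} {A B : Set (Coord → ℤˣ)} (hA : Determined S A)
    (hB : Determined S B) : Determined S (A ∩ B) :=
  fun _ _ hc h => ⟨hA hc h.1, hB hc h.2⟩

theorem Determined.compl {S : Set Coord} {A : Set (Coord → ℤˣ)} (hA : Determined S A) :
    Determined S Aᶜ := fun _ _ hc h h' => h (hA hc.symm h')

theorem Determined.iUnion {ι : Sort*} {S : Set Coord} {A : ι → Set (Coord → ℤˣ)}
    (hA : ∀ i, Determined S (A i)) : Determined S (⋃ i, A i) := fun _ _ hc h => by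
  obtain ⟨i, hi⟩ := Set.mem_iUnion.1 h
  exact Set.mem_iUnion.2 ⟨i, hA i hc hi⟩

theorem determined_leaves (S : Set Coord) (x v e : Coord) :
    Determined S {c | Leaves S x v c e} := by
  rintro c c' hc ⟨T, hT, hT', he⟩
  refine ⟨T, fun t ht => ?_, ?_, ?_⟩
  · rw [target_congr hc fun u hu => hT u (hu.trans ht)]
    exact hT t ht
  · rwa [target_congr hc hT]
  · rwa [(move_iterate_congr hc hT).1]

theorem determined_leavesOrStays (S : Set Coord) (x v : Coord) (o : Option Coord) :
    Determined S {c | LeavesOrStays S x v c o} := by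
  cases o with
  | some e => exact determined_leaves S x v e
  | none =>
    intro c c' hc h t
    rw [target_congr hc fun u _ => h u]
    exact h t

theorem determined_matches (l : List (Coord × ℤˣ)) :
    Determined (sites l) {c | Matches c l} := fun _ _ hc h => Matches.congr h hc

theorem Leaves.unique {S : Set Coord} {x v e e' : Coord} {c : Coord → ℤˣ} (h : Leaves S x v c e)
    (h' : Leaves S x v c e') : e = e' := by
  obtain ⟨T, h1, h2, rfl⟩ := h
  obtain ⟨T', h1', h2', rfl⟩ := h'
  rcases lt_trichotomy T T' with hT | rfl | hT
  · exact absurd (h1' T hT) h2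
  · rfl
  · exact absurd (h1 T' hT) h2'

theorem LeavesOrStays.unique {S : Set Coord} {x v : Coord} {o o' : Option Coord}
    {c : Coord → ℤˣ} (h : LeavesOrStays S x v c o) (h' : LeavesOrStays S x v c o') : o = o' := by
  cases o <;> cases o'
  · rfl
  · obtain ⟨T, -, hT, -⟩ := h'
    exact absurd (h T) hT
  · obtain ⟨T, -, hT, -⟩ := h
    exact absurd (h' T) hT
  · exact congrArg some (Leaves.unique h h')

theorem exists_leavesOrStays (S : Set Coord) (x v : Coord) (c : Coord → ℤˣ) :
    ∃ o, LeavesOrStays S x v c o := by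
  classical
  by_cases h : ∃ t, target (move^[t] (x, v, c)) ∉ S
  · exact ⟨some _, Nat.find h, fun t ht => not_not.1 (Nat.find_min h ht), Nat.find_spec h, rfl⟩
  · exact ⟨none, by simpa [LeavesOrStays] using h⟩

/-! ### Random fields of scatterers -/

/-- Independent scatterers on the sites of the honeycomb lattice, in lattice coordinates, for which
either orientation has probability at least `ε`. -/
structure IsRandomField {Ω : Type*} [MeasurableSpace Ω] (P : Measure Ω) (ε : ℝ≥0∞)
    (X : Ω → Coord → ℤˣ) : Prop where
  measurable : Measurable X
  indep : iIndepFun (fun (q : {q : Coord // (q.1 - q.2) % 3 ≠ 2}) ω => X ω q) P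
  const : ∀ q : Coord, (q.1 - q.2) % 3 = 2 → ∀ ω, X ω q = 1
  prob : ∀ q : Coord, (q.1 - q.2) % 3 ≠ 2 → ∀ z, ε ≤ P {ω | X ω q = z}

section Field

variable {Ω : Type*} [MeasurableSpace Ω] {P : Measure Ω} {ε : ℝ≥0∞} {X : Ω → Coord → ℤˣ}

/-- The events that depend on the scatterers in `S`. -/
@[reducible]
def fieldSigma (X : Ω → Coord → ℤˣ) (S : Set Coord) : MeasurableSpace Ω :=
  ⨆ q ∈ {q : {q : Coord // (q.1 - q.2) % 3 ≠ 2} | q.1 ∈ S},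
    MeasurableSpace.comap (fun ω => X ω q.1) inferInstance

theorem IsRandomField.measurableSet_preimage (hX : IsRandomField P ε X) {S : Set Coord}
    {A : Set (Coord → ℤˣ)} (hA : MeasurableSet A) (hAS : Determined S A) :
    MeasurableSet[fieldSigma X S] (X ⁻¹' A) := by
  classical
  have key : X ⁻¹' A = (fun ω q => if q ∈ S then X ω q else 1) ⁻¹' A := by
    ext ω
    exact ⟨fun h => hAS (fun q hq => if_pos hq) h, fun h => hAS (fun q hq => (if_pos hq).symm) h⟩
  -- Resetting the field to 1 off `S` does not affect the event, and the truncated field is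
  -- measurable with respect to the scatterers in `S`.
  rw [key]
  have hm : Measurable[fieldSigma X S] (fun ω q => if q ∈ S then X ω q else 1) := by
    refine @measurable_pi_lambda _ _ _ (fieldSigma X S) _ _ fun q => ?_
    by_cases hq : q ∈ S
    · simp only [if_pos hq]
      by_cases hs : (q.1 - q.2) % 3 = 2
      · simp only [hX.const q hs]
        exact measurable_const
      · rw [measurable_iff_comap_le]
        exact le_iSup₂_of_le (f := fun (q : {q : Coord // (q.1 - q.2) % 3 ≠ 2})
          (_ : q ∈ {q : {q : Coord // (q.1 - q.2) % 3 ≠ 2} | q.1 ∈ S}) =>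
          MeasurableSpace.comap (fun ω => X ω q.1) inferInstance) ⟨q, hs⟩ hq le_rfl
    · simp only [if_neg hq]
      exact measurable_const
  exact hm hA

theorem IsRandomField.measure_inter (hX : IsRandomField P ε X) {S T : Set Coord}
    (hST : Disjoint S T) {A B : Set (Coord → ℤˣ)} (hA : MeasurableSet A) (hAS : Determined S A)
    (hB : MeasurableSet B) (hBT : Determined T B) :
    P (X ⁻¹' (A ∩ B)) = P (X ⁻¹' A) * P (X ⁻¹' B) := by
  have hi : Indep (fieldSigma X S) (fieldSigma X T) P :=
    indep_iSup_of_disjoint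
      (m := fun q : {q : Coord // (q.1 - q.2) % 3 ≠ 2} =>
        MeasurableSpace.comap (fun ω => X ω q.1) inferInstance)
      (fun q => ((measurable_pi_apply q.1).comp hX.measurable).comap_le) hX.indep
      (Set.disjoint_left.2 fun q hq hq' => Set.disjoint_left.1 hST hq hq')
  exact (Indep_iff _ _ _).1 hi _ _ (hX.measurableSet_preimage hA hAS)
    (hX.measurableSet_preimage hB hBT)

/-- Distinct sites are independent, and each listed orientation costs a factor of at least `ε`.
Hexagon centres must be excluded, since the field is constant there. -/
theorem IsRandomField.pow_le_measure_matches [IsProbabilityMeasure P] (hX : IsRandomField P ε X)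
    {l : List (Coord × ℤˣ)} (hl : (l.map Prod.fst).Nodup)
    (hs : ∀ a ∈ l, (a.1.1 - a.1.2) % 3 ≠ 2) : ε ^ l.length ≤ P (X ⁻¹' {c | Matches c l}) := by
  induction l with
  | nil => simp [Matches]
  | cons a l ih =>
    rw [List.map_cons, List.nodup_cons] at hl
    have h1 : {c | Matches c (a :: l)} = {c | Matches c [a]} ∩ {c | Matches c l} := by
      ext c
      simp [Matches]
    have h2 : Disjoint (sites [a]) (sites l) := by
      rw [Set.disjoint_left]
      intro q hq hq'
      have : q = a.1 := by simpa [sites] using hq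
      exact hl.1 (this ▸ hq')
    have h3 : X ⁻¹' {c | Matches c [a]} = {ω | X ω a.1 = a.2} := by
      ext ω
      simp [Matches]
    rw [h1, hX.measure_inter h2 (measurableSet_matches _) (determined_matches _)
      (measurableSet_matches _) (determined_matches _), h3, List.length_cons, pow_succ']
    exact mul_le_mul' (hX.prob _ (hs a List.mem_cons_self) _)
      (ih hl.2 fun b hb => hs b (List.mem_cons_of_mem _ hb))

end Field

/-! ### Escape through successive strips -/

/-- A list of scatterers beyond a half plane that can be realized with positive probability. -/
structure IsAdmissible (k : ℕ) (l : List (Coord × ℤˣ)) : Prop where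
  nodup : (l.map Prod.fst).Nodup
  site : ∀ a ∈ l, (a.1.1 - a.1.2) % 3 ≠ 2
  height_mem : ∀ a ∈ l, 12 * k < height a.1 ∧ height a.1 ≤ 12 * (k + 1)

theorem IsReflector.isAdmissible {l : List (Coord × ℤˣ)} {N : ℕ} (hl : IsReflector l N) {k : ℕ}
    {e : Coord} (he : height e = 12 * k) (he' : (e.1 - e.2) % 3 = 0) :
    IsAdmissible k (shift e l) where
  nodup := by
    have : (shift e l).map Prod.fst = (l.map Prod.fst).map (e + ·) := by
      simp [shift, Function.comp_def]
    rw [this]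
    exact hl.nodup.map (add_right_injective e)
  site a ha := by
    obtain ⟨b, hb, rfl⟩ := List.mem_map.1 ha
    have := hl.site b hb
    simp
    omega
  height_mem a ha := by
    obtain ⟨b, hb, rfl⟩ := List.mem_map.1 ha
    have := hl.height_mem b hb
    simp [height] at *
    omega

theorem IsAdmissible.append {k : ℕ} {l l' : List (Coord × ℤˣ)} (h : IsAdmissible k l)
    (h' : IsAdmissible k l') (hd : Disjoint (sites l) (sites l')) : IsAdmissible k (l ++ l') where
  nodup := by
    rw [List.map_append]
    exact h.nodup.append h'.nodup fun q hq hq' => Set.disjoint_left.1 hd hq hq'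
  site a ha := (List.mem_append.1 ha).elim (h.site a) (h'.site a)
  height_mem a ha := (List.mem_append.1 ha).elim (h.height_mem a) (h'.height_mem a)

/-- The particle leaves the half plane from `e`, and the reversed particle leaves it or stays in it
as prescribed by `o`. -/
def exitEvent (k : ℕ) (x v : Coord) (y : Coord × Option Coord) : Set (Coord → ℤˣ) :=
  {c | Leaves (region k) x v c y.1} ∩ {c | LeavesOrStays (region k) (x + v) (-v) c y.2}

/-- The particle leaves the half plane without meeting the confining structures. -/
def escapeEvent (k : ℕ) (x v : Coord) : Set (Coord → ℤˣ) :=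
  ⋃ y : Coord × Option Coord, exitEvent k x v y ∩ {c | Matches c (confinement y.1 y.2)}ᶜ

theorem isAdmissible_confinement {k : ℕ} {x v : Coord} (hb : IsBond x v) (hx : x ∈ region k)
    (hxv : x + v ∈ region k) {y : Coord × Option Coord} {c : Coord → ℤˣ}
    (hc : c ∈ exitEvent k x v y) :
    IsAdmissible k (confinement y.1 y.2) ∧ (confinement y.1 y.2).length ≤ 40 := by
  obtain ⟨e, o⟩ := y
  obtain ⟨h : Leaves (region k) x v c e, h'⟩ := hc
  obtain ⟨he, he'⟩ := h.cross hb hx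
  cases o with
  | none => exact ⟨isReflector_upper.isAdmissible he he', by simp [confinement, shift,
      isReflector_upper.length]⟩
  | some f =>
    obtain ⟨hf, hf'⟩ := Leaves.cross h' hb.reverse hxv
    simp only [confinement]
    split_ifs with h1 h2
    · exact ⟨isReflector_upper.isAdmissible he he', by simp [shift, isReflector_upper.length]⟩
    · exact ⟨(isReflector_lower.isAdmissible he he').append (isReflector_upper.isAdmissible hf hf')
        (disjoint_lower_upper h2),
        by simp [shift, isReflector_upper.length, isReflector_lower.length]⟩
    · have h3 : f.2 < e.2 := by
        by_contra h3
        refine h1 (Prod.ext ?_ ?_) <;> simp only [height] at he hf <;> omega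
      exact ⟨(isReflector_upper.isAdmissible he he').append (isReflector_lower.isAdmissible hf hf')
        (disjoint_lower_upper h3).symm,
        by simp [shift, isReflector_upper.length, isReflector_lower.length]⟩

theorem region_mono {k k' : ℕ} (h : k ≤ k') : region k ⊆ region k' := fun q hq => by
  simp only [region, Set.mem_ofPred_eq] at *
  omega

theorem IsAdmissible.sites_subset {k : ℕ} {l : List (Coord × ℤˣ)} (h : IsAdmissible k l) :
    sites l ⊆ region (k + 1) := fun q hq => by
  have : height q ≤ 12 * (k + 1) := (h.height_mem _ (mem_of_mem_sites hq)).2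
  simpa [region] using this

theorem IsAdmissible.disjoint {k : ℕ} {l : List (Coord × ℤˣ)} (h : IsAdmissible k l) :
    Disjoint (region k) (sites l) := Set.disjoint_right.2 fun q hq hq' => by
  have : 12 * k < height q := (h.height_mem _ (mem_of_mem_sites hq)).1
  simp only [region, Set.mem_ofPred_eq] at hq'
  omega

theorem measurableSet_exitEvent (k : ℕ) (x v : Coord) (y : Coord × Option Coord) :
    MeasurableSet (exitEvent k x v y) :=
  (measurableSet_leaves _ _ _ _).inter (measurableSet_leavesOrStays _ _ _ _)

theorem determined_exitEvent (k : ℕ) (x v : Coord) (y : Coord × Option Coord) :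
    Determined (region k) (exitEvent k x v y) :=
  (determined_leaves _ _ _ _).inter (determined_leavesOrStays _ _ _ _)

theorem measurableSet_escapeEvent (k : ℕ) (x v : Coord) : MeasurableSet (escapeEvent k x v) :=
  MeasurableSet.iUnion fun y =>
    (measurableSet_exitEvent k x v y).inter (measurableSet_matches _).compl

/-- The exits are decided inside `region k`, and the structures they call for end at height `12 * (k
+ 1)`. This makes successive escape events suitable for iteration. -/
theorem determined_escapeEvent {k : ℕ} {x v : Coord} (hb : IsBond x v) (hx : x ∈ region k)
    (hxv : x + v ∈ region k) : Determined (region (k + 1)) (escapeEvent k x v) := by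
  refine Determined.iUnion fun y c c' hc h => ?_
  have hadm := (isAdmissible_confinement hb hx hxv h.1).1
  exact ⟨(determined_exitEvent k x v y).mono (region_mono (Nat.le_succ k)) hc h.1,
    ((determined_matches _).mono hadm.sites_subset).compl hc h.2⟩

section Field

variable {Ω : Type*} [MeasurableSpace Ω] {P : Measure Ω} [IsProbabilityMeasure P] {ε : ℝ≥0∞}
  {X : Ω → Coord → ℤˣ}

theorem IsRandomField.le_one (hX : IsRandomField P ε X) : ε ≤ 1 :=
  (hX.prob 0 (by decide) 1).trans prob_le_one

/-- Given the pair of exits, the required structure is a fixed list beyond the half plane,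
independent of `Z` and of the exits. The exit events are disjoint, so summing over the countably
many pairs keeps the factor `1 - ε ^ 40`. -/
theorem IsRandomField.measure_inter_escapeEvent_le (hX : IsRandomField P ε X) {k : ℕ}
    {x v : Coord} (hb : IsBond x v) (hx : x ∈ region k) (hxv : x + v ∈ region k)
    {Z : Set (Coord → ℤˣ)} (hZ : MeasurableSet Z) (hZk : Determined (region k) Z) :
    P (X ⁻¹' (Z ∩ escapeEvent k x v)) ≤ P (X ⁻¹' Z) * (1 - ε ^ 40) := by
  have hle (y : Coord × Option Coord) :
      P (X ⁻¹' (Z ∩ exitEvent k x v y ∩ {c | Matches c (confinement y.1 y.2)}ᶜ)) ≤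
        P (X ⁻¹' (Z ∩ exitEvent k x v y)) * (1 - ε ^ 40) := by
    rcases Set.eq_empty_or_nonempty (exitEvent k x v y) with h | ⟨c, hc⟩
    · simp [h]
    · obtain ⟨hadm, hlen⟩ := isAdmissible_confinement hb hx hxv hc
      rw [hX.measure_inter hadm.disjoint (hZ.inter (measurableSet_exitEvent k x v y))
        (hZk.inter (determined_exitEvent k x v y)) (measurableSet_matches _).compl
        (determined_matches _).compl]
      gcongr
      rw [Set.preimage_compl, prob_compl_eq_one_sub (hX.measurable (measurableSet_matches _))]
      gcongr
      -- Two reflectors of 20 sites each are the worst case, and `ε ≤ 1`.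
      exact (pow_le_pow_right_of_le_one' hX.le_one hlen).trans
        (hX.pow_le_measure_matches hadm.nodup hadm.site)
  have hdis : Pairwise (Function.onFun Disjoint fun y => X ⁻¹' (Z ∩ exitEvent k x v y)) := by
    intro y y' hy
    refine Set.disjoint_left.2 fun ω hω hω' => hy ?_
    exact Prod.ext (Leaves.unique hω.2.1 hω'.2.1) (LeavesOrStays.unique hω.2.2 hω'.2.2)
  calc P (X ⁻¹' (Z ∩ escapeEvent k x v))
      = P (⋃ y, X ⁻¹' (Z ∩ exitEvent k x v y ∩ {c | Matches c (confinement y.1 y.2)}ᶜ)) := by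
        rw [escapeEvent, Set.inter_iUnion, Set.preimage_iUnion]
        simp only [Set.inter_assoc]
    _ ≤ ∑' y, P (X ⁻¹' (Z ∩ exitEvent k x v y ∩ {c | Matches c (confinement y.1 y.2)}ᶜ)) :=
        measure_iUnion_le _
    _ ≤ ∑' y, P (X ⁻¹' (Z ∩ exitEvent k x v y)) * (1 - ε ^ 40) := ENNReal.tsum_le_tsum hle
    _ = P (⋃ y, X ⁻¹' (Z ∩ exitEvent k x v y)) * (1 - ε ^ 40) := by
        rw [ENNReal.tsum_mul_right, measure_iUnion hdis fun y =>
          hX.measurable (hZ.inter (measurableSet_exitEvent k x v y))]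
    _ ≤ P (X ⁻¹' Z) * (1 - ε ^ 40) := by
        gcongr
        exact Set.iUnion_subset fun y => Set.preimage_mono Set.inter_subset_left

theorem IsRandomField.measure_iInter_escapeEvent (hX : IsRandomField P ε X) (hε : ε ≠ 0) {k : ℕ}
    {x v : Coord} (hb : IsBond x v) (hx : x ∈ region k) (hxv : x + v ∈ region k) :
    P (X ⁻¹' ⋂ j : ℕ, escapeEvent (k + j) x v) = 0 := by
  -- `Z` is the intersection of the first `J` escape events; recording that it is determined by
  -- `region (k + J)` is what permits the next factor.
  have h (J : ℕ) : ∃ Z, MeasurableSet Z ∧ Determined (region (k + J)) Z ∧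
      P (X ⁻¹' Z) ≤ (1 - ε ^ 40) ^ J ∧ ⋂ j : ℕ, escapeEvent (k + j) x v ⊆ Z := by
    induction J with
    | zero => exact ⟨Set.univ, .univ, fun _ _ _ _ => trivial, by simp, Set.subset_univ _⟩
    | succ J ih =>
      obtain ⟨Z, hZ, hZd, hZP, hZs⟩ := ih
      have hk := region_mono (Nat.le_add_right k J)
      refine ⟨Z ∩ escapeEvent (k + J) x v, hZ.inter (measurableSet_escapeEvent _ _ _),
        (hZd.mono (region_mono (Nat.le_succ _))).inter
          (determined_escapeEvent hb (hk hx) (hk hxv)), ?_,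
        Set.subset_inter hZs (Set.iInter_subset _ J)⟩
      rw [pow_succ]
      refine (hX.measure_inter_escapeEvent_le hb (hk hx) (hk hxv) hZ hZd).trans ?_
      gcongr
  have hlt : 1 - ε ^ 40 < 1 :=
    ENNReal.sub_lt_self ENNReal.one_ne_top one_ne_zero (pow_ne_zero _ hε)
  refine le_antisymm (ge_of_tendsto' (ENNReal.tendsto_pow_atTop_nhds_zero_of_lt_one hlt)
    fun J => ?_) zero_le
  obtain ⟨Z, -, -, hZP, hZs⟩ := h J
  exact (measure_mono (Set.preimage_mono hZs)).trans hZP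

/-- Almost surely, the particle remains bounded in the direction `(1, 0)`. -/
theorem IsRandomField.ae_bddAbove (hX : IsRandomField P ε X) (hε : ε ≠ 0) {x v : Coord}
    (hb : IsBond x v) :
    ∀ᵐ ω ∂P, BddAbove (Set.range fun t => height (move^[t] (x, v, X ω)).1) := by
  obtain ⟨k, hx, hxv⟩ : ∃ k : ℕ, x ∈ region k ∧ x + v ∈ region k := by
    refine ⟨(height x).toNat + (height (x + v)).toNat, ?_, ?_⟩ <;>
      simp only [region, Set.mem_ofPred_eq] <;> omega
  have h0 := hX.measure_iInter_escapeEvent hε hb hx hxv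
  filter_upwards [measure_eq_zero_iff_ae_notMem.1 h0] with ω hω
  by_contra hub
  -- An unbounded height forces an escape from every half plane: staying inside, or meeting the
  -- confining structures, would bound it.
  refine hω (Set.mem_iInter.2 fun j => ?_)
  have hk := region_mono (Nat.le_add_right k j)
  obtain ⟨o, ho⟩ := exists_leavesOrStays (region (k + j)) x v (X ω)
  obtain ⟨o', ho'⟩ := exists_leavesOrStays (region (k + j)) (x + v) (-v) (X ω)
  cases o with
  | none =>
    refine absurd ⟨12 * ((k + j : ℕ) : ℤ), ?_⟩ hub
    rintro _ ⟨t, rfl⟩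
    exact pos_mem_of_target_mem (s := (x, v, X ω)) (hk hx) fun u _ => ho u
  | some e =>
    exact Set.mem_iUnion.2 ⟨(e, o'), ⟨ho, ho'⟩,
      fun hm => hub (bddAbove_of_confinement hb (hk hx) (hk hxv) ho ho' hm)⟩

end Field

/-! ### Boundedness in three directions and return -/

/-- Rotation by `2π/3`. -/
def rotation : Coord →+ Coord where
  toFun q := (-q.1 - q.2, q.1)
  map_zero' := by simp
  map_add' q r := by ext <;> (simp; try ring)

/-- Rotation by `-2π/3`. -/
def rotationInv : Coord →+ Coord where
  toFun q := (q.2, -q.1 - q.2)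
  map_zero' := by simp
  map_add' q r := by ext <;> (simp; try ring)

theorem rotation_rotationInv (q : Coord) : rotation (rotationInv q) = q := by
  ext <;> simp only [rotation, rotationInv, AddMonoidHom.coe_mk, ZeroHom.coe_mk]; ring

theorem rotationInv_rotation (q : Coord) : rotationInv (rotation q) = q := by
  ext <;> simp [rotation, rotationInv]

theorem rotationInv_injective : Function.Injective rotationInv :=
  Function.LeftInverse.injective rotation_rotationInv

theorem turn_rotationInv (z : ℤˣ) (v : Coord) :
    turn z (rotationInv v) = rotationInv (turn z v) := by
  rcases Int.units_eq_one_or z with rfl | rfl <;> ext <;> simp [turn, rotationInv, add_comm]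

theorem rotationInv_mod (q : Coord) :
    ((rotationInv q).1 - (rotationInv q).2) % 3 = (q.1 - q.2) % 3 := by
  simp only [rotationInv, AddMonoidHom.coe_mk, ZeroHom.coe_mk]
  omega

theorem IsBond.rotation {v : Coord} (h : IsBond 0 v) : IsBond 0 (rotation v) := by
  rcases h with ⟨-, rfl | rfl | rfl⟩ | ⟨h, -⟩
  · simp [IsBond, FlippingRotator.rotation]
  · simp [IsBond, FlippingRotator.rotation]
  · simp [IsBond, FlippingRotator.rotation]
  · simp at h

/-- Scatterers off the finite range are never touched, and a velocity is the difference of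
consecutive positions. Finitely many data thus fix the state, so two times share it, and injectivity
of the motion pulls the coincidence back to time zero. -/
theorem exists_return_of_finite_range {s : CState}
    (h : (Set.range fun t => (move^[t] s).1).Finite) : ∃ N, 0 < N ∧ move^[N] s = s := by
  set F := Set.range fun t => (move^[t] s).1 with hF
  have hmem (t : ℕ) : (move^[t] s).1 ∈ F := ⟨t, rfl⟩
  have htarget (t : ℕ) : target (move^[t] s) = (move^[t + 1] s).1 := by
    rw [Function.iterate_succ_apply']
    rfl
  have hconf (t : ℕ) : Set.EqOn (move^[t] s).2.2 s.2.2 Fᶜ :=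
    (move_iterate_congr (x := s.1) (v := s.2.1) (c := s.2.2) (S := F) (T := t) (fun _ _ => rfl)
      fun u _ => (htarget u) ▸ hmem (u + 1)).2.2.2
  have : Finite F := h
  obtain ⟨t, u, htu, he⟩ := Finite.exists_ne_map_eq_of_infinite
    fun t : ℕ => ((⟨_, hmem t⟩, ⟨_, hmem (t + 1)⟩, fun q => (move^[t] s).2.2 q) :
      F × F × (F → ℤˣ))
  simp only [Prod.mk.injEq, Subtype.mk.injEq, ← htarget] at he
  obtain ⟨h1, h2, h3⟩ := he
  have hs : move^[t] s = move^[u] s := by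
    refine Prod.ext h1 (Prod.ext ?_ (funext fun q => ?_))
    · rw [target, target, h1] at h2
      exact add_left_cancel h2
    · by_cases hq : q ∈ F
      · exact congrFun h3 ⟨q, hq⟩
      · rw [hconf t hq, hconf u hq]
  have key {t u : ℕ} (htu : t < u) (hs : move^[t] s = move^[u] s) :
      ∃ N, 0 < N ∧ move^[N] s = s := by
    refine ⟨u - t, by omega, move_injective.iterate t ?_⟩
    rw [← Function.iterate_add_apply, Nat.add_sub_cancel' htu.le, hs]
  rcases lt_or_gt_of_ne htu with h | h
  · exact key h hs
  · exact key h hs.symm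

section Field

variable {Ω : Type*} [MeasurableSpace Ω] {P : Measure Ω} {ε : ℝ≥0∞} {X : Ω → Coord → ℤˣ}

theorem IsRandomField.comp_rotationInv (hX : IsRandomField P ε X) :
    IsRandomField P ε fun ω q => X ω (rotationInv q) where
  measurable := measurable_pi_iff.2 fun q => (measurable_pi_apply (rotationInv q)).comp
    hX.measurable
  indep := hX.indep.precomp (g := fun q : {q : Coord // (q.1 - q.2) % 3 ≠ 2} =>
      ⟨rotationInv q.1, by rw [rotationInv_mod]; exact q.2⟩)
    fun q r h => Subtype.ext (rotationInv_injective (congrArg Subtype.val h))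
  const q hq := hX.const _ (by rw [rotationInv_mod, hq])
  prob q hq := hX.prob _ (by rwa [rotationInv_mod])

/-- The rotated field is again a random field with the same `ε`, and the dynamics commutes with the
rotation. The bound `hg` is assumed for every field and bond direction so that the lemma can be
applied twice. -/
theorem IsRandomField.ae_bddAbove_rotation {g : Coord → ℤ}
    (hg : ∀ {X}, IsRandomField P ε X → ∀ {v}, IsBond 0 v →
      ∀ᵐ ω ∂P, BddAbove (Set.range fun t => g (move^[t] (0, v, X ω)).1))
    (hX : IsRandomField P ε X) {v : Coord} (hv : IsBond 0 v) :
    ∀ᵐ ω ∂P, BddAbove (Set.range fun t => g (rotation (move^[t] (0, v, X ω)).1)) := by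
  filter_upwards [hg hX.comp_rotationInv hv.rotation] with ω hω
  convert hω using 4 with t
  have := (move_iterate_map rotationInv_injective turn_rotationInv 0 (S := Set.univ)
    (s := (0, rotation v, fun q => X ω (rotationInv q))) (s' := (0, v, X ω)) (T := t)
    (by simp) (rotationInv_rotation v).symm (fun q _ => by simp) fun _ _ => trivial).1
  rw [this, zero_add, rotation_rotationInv]

/-- Almost surely, the particle returns to its initial state. -/
theorem IsRandomField.ae_return [IsProbabilityMeasure P] (hX : IsRandomField P ε X) (hε : ε ≠ 0)
    {v : Coord} (hv : IsBond 0 v) :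
    ∀ᵐ ω ∂P, ∃ N, 0 < N ∧ move^[N] (0, v, X ω) = (0, v, X ω) := by
  have h1 {X} (hX : IsRandomField P ε X) {v : Coord} (hv : IsBond 0 v) := hX.ae_bddAbove hε hv
  have h2 {X} (hX : IsRandomField P ε X) {v : Coord} (hv : IsBond 0 v) :=
    hX.ae_bddAbove_rotation (g := height) h1 hv
  have h3 {X} (hX : IsRandomField P ε X) {v : Coord} (hv : IsBond 0 v) :=
    hX.ae_bddAbove_rotation (g := fun q => height (rotation q)) h2 hv
  filter_upwards [h1 hX hv, h2 hX hv, h3 hX hv] with ω ⟨a, ha⟩ ⟨b, hb⟩ ⟨c, hc⟩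
  -- The three heights `2 m + n`, `-m - 2 n` and `n - m` sum to zero, so upper bounds `a`, `b`, `c`
  -- also bound each from below, hence bound both coordinates.
  refine exists_return_of_finite_range
    ((Set.finite_Icc ((-|a| - |b| - |c|, -|a| - |b| - |c|) : Coord)
      (|a| + |b| + |c|, |a| + |b| + |c|)).subset ?_)
  rintro _ ⟨t, rfl⟩
  have ha := ha ⟨t, rfl⟩
  have hb := hb ⟨t, rfl⟩
  have hc := hc ⟨t, rfl⟩
  simp only [height, rotation, AddMonoidHom.coe_mk, ZeroHom.coe_mk] at ha hb hc
  simp only [Set.mem_Icc, Prod.le_def]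
  generalize (move^[t] (0, v, X ω)).1 = q at *
  have := le_abs_self a
  have := le_abs_self b
  have := le_abs_self c
  have := abs_nonneg a
  have := abs_nonneg b
  have := abs_nonneg c
  omega

end Field

/-! ### From the Euclidean plane to lattice coordinates -/

theorem latticePoint_inj {m n m' n' : ℤ} (h : latticePoint m n = latticePoint m' n') :
    m = m' ∧ n = n' := by
  have h1 := congrArg (fun x : Plane => x 1) h
  have h0 := congrArg (fun x : Plane => x 0) h
  simp only [latticePoint, PiLp.toLp_apply, Matrix.cons_val_zero, Matrix.cons_val_one] at h0 h1
  have hn : (n : ℝ) = n' := mul_right_cancel₀ (by positivity) h1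
  rw [hn] at h0
  exact ⟨by exact_mod_cast add_right_cancel h0, by exact_mod_cast hn⟩

theorem latticePoint_mem_honeycomb {m n : ℤ} :
    latticePoint m n ∈ honeycomb ↔ (m - n) % 3 ≠ 2 := by
  constructor
  · rintro ⟨m', n', h, he⟩
    obtain ⟨rfl, rfl⟩ := latticePoint_inj he
    exact h
  · exact fun h => ⟨m, n, h, rfl⟩

open Classical in
/-- The configuration in lattice coordinates, extended by `1` to the centres of the hexagons. -/
noncomputable def Configuration.toCoord (C : Configuration) (q : Coord) : ℤˣ :=
  if h : latticePoint q.1 q.2 ∈ honeycomb then C ⟨latticePoint q.1 q.2, h⟩ else 1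

/-- The state `a` describes the state `s` in lattice coordinates. -/
structure Represents (s : State) (a : CState) : Prop where
  pos : (s.pos : Plane) = latticePoint a.1.1 a.1.2
  vel : s.vel = latticePoint a.2.1.1 a.2.1.2
  conf : s.conf.toCoord = a.2.2

theorem rotate_latticePoint (z : ℤˣ) (v : Coord) :
    rotate z (latticePoint v.1 v.2) = latticePoint (turn z v).1 (turn z v).2 := by
  rcases Int.units_eq_one_or z with rfl | rfl
  · simp [rotate_one_latticePoint, turn]
  · simp [rotate_neg_one_latticePoint, turn]

theorem Represents.step {s : State} {a : CState} (h : Represents s a) :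
    Represents s.step (move a) := by
  have ht : (s.pos : Plane) + s.vel = latticePoint (target a).1 (target a).2 := by
    rw [h.pos, h.vel, latticePoint_add]
    rfl
  have hmem : latticePoint (target a).1 (target a).2 ∈ honeycomb := ht ▸ s.mem
  have hc : s.conf ⟨s.pos + s.vel, s.mem⟩ = a.2.2 (target a) := by
    rw [← h.conf, Configuration.toCoord, dif_pos hmem]
    congr 2
  refine ⟨ht, ?_, funext fun q => ?_⟩
  · change rotate (s.conf ⟨s.pos + s.vel, s.mem⟩) s.vel = _
    rw [hc, h.vel, rotate_latticePoint]
    rfl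
  · change _ = Function.update a.2.2 (target a) (-a.2.2 (target a)) q
    by_cases hq : q = target a
    · subst hq
      rw [Function.update_self, Configuration.toCoord, dif_pos hmem, ← hc]
      change ite _ _ _ = _
      rw [if_pos ht.symm]
      congr 3
      exact ht.symm
    · rw [Function.update_of_ne hq, ← h.conf, Configuration.toCoord, Configuration.toCoord]
      split_ifs with hh
      · change ite _ _ _ = _
        rw [if_neg]
        rw [ht]
        intro he
        exact hq (Prod.ext (latticePoint_inj he).1 (latticePoint_inj he).2)
      · rfl

theorem Represents.iterate {s : State} {a : CState} (h : Represents s a) (t : ℕ) :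
    Represents (State.step^[t] s) (move^[t] a) := by
  induction t with
  | zero => exact h
  | succ t ih =>
    rw [Function.iterate_succ_apply', Function.iterate_succ_apply']
    exact ih.step

theorem represents_initialCondition (C : Configuration) :
    Represents (initialCondition C) (0, (1, 0), C.toCoord) where
  pos := by
    ext i
    fin_cases i <;> simp [initialCondition, latticePoint]
  vel := by
    ext i
    fin_cases i <;> simp [initialCondition, latticePoint]
  conf := rfl

theorem isPeriodic_of_return {C : Configuration} {N : ℕ} (hN : 0 < N)
    (h : move^[N] (0, (1, 0), C.toCoord) = (0, (1, 0), C.toCoord)) :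
    IsPeriodic (trajectory (initialCondition C)) := by
  refine ⟨N, hN, fun t => Subtype.ext ?_⟩
  have hr := (represents_initialCondition C).iterate
  rw [trajectory, trajectory, (hr t).pos, (hr (t + N)).pos, Function.iterate_add_apply, h]

theorem IsRandomConfiguration.isRandomField {Ω : Type*} [MeasurableSpace Ω] {P : Measure Ω}
    [IsProbabilityMeasure P] {p : ℝ} (hp : p ∈ Set.Ioo (0 : ℝ) 1) {C : Site → Ω → ℤˣ}
    (hC : IsRandomConfiguration P p C) :
    IsRandomField P (min (ENNReal.ofReal p) (ENNReal.ofReal (1 - p)))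
      fun ω => Configuration.toCoord fun h => C h ω := by
  have hX (q : Coord) (hq : (q.1 - q.2) % 3 ≠ 2) :
      (fun ω => Configuration.toCoord (fun h => C h ω) q) =
        C ⟨latticePoint q.1 q.2, latticePoint_mem_honeycomb.2 hq⟩ :=
    funext fun ω => dif_pos _
  have hconst (q : Coord) (hq : (q.1 - q.2) % 3 = 2) (ω : Ω) :
      Configuration.toCoord (fun h => C h ω) q = 1 :=
    dif_neg fun h => latticePoint_mem_honeycomb.1 h hq
  refine ⟨measurable_pi_iff.2 fun q => ?_, ?_, hconst, fun q hq z => ?_⟩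
  · by_cases hq : (q.1 - q.2) % 3 = 2
    · simp only [hconst q hq]
      exact measurable_const
    · rw [hX q hq]
      exact hC.measurable _
  · have := hC.indep.precomp (g := fun q : {q : Coord // (q.1 - q.2) % 3 ≠ 2} =>
      (⟨latticePoint q.1.1 q.1.2, latticePoint_mem_honeycomb.2 q.2⟩ : Site)) fun q r h =>
        Subtype.ext (Prod.ext (latticePoint_inj (congrArg Subtype.val h)).1
          (latticePoint_inj (congrArg Subtype.val h)).2)
    convert this using 2 with q
    exact hX q.1 q.2
  · have h1 (ω : Ω) := congrFun (hX q hq) ω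
    simp only [h1]
    set h : Site := ⟨latticePoint q.1 q.2, latticePoint_mem_honeycomb.2 hq⟩
    rcases Int.units_eq_one_or z with rfl | rfl
    · rw [hC.prob_right]
      exact min_le_left _ _
    · have hcompl : {ω | C h ω = -1} = {ω | C h ω = 1}ᶜ := by
        ext ω
        rcases Int.units_eq_one_or (C h ω) with h | h <;> simp [h]
      have hm : MeasurableSet {ω | C h ω = 1} := hC.measurable h (MeasurableSet.singleton 1)
      rw [hcompl, prob_compl_eq_one_sub hm, hC.prob_right, ENNReal.ofReal_sub _ hp.1.le,
        ENNReal.ofReal_one]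
      exact min_le_right _ _

end FlippingRotator

theorem mainTheorem1 {Ω : Type*} [MeasurableSpace Ω] (P : MeasureTheory.Measure Ω)
    [MeasureTheory.IsProbabilityMeasure P] (p : ℝ) (hp : p ∈ Set.Ioo (0 : ℝ) 1)
    (C : FlippingRotator.Site → Ω → ℤˣ) (hC : FlippingRotator.IsRandomConfiguration P p C) :
    ∀ᵐ ω ∂P, FlippingRotator.IsPeriodic
      (FlippingRotator.trajectory (FlippingRotator.initialCondition fun h => C h ω)) := by
  have hε : min (ENNReal.ofReal p) (ENNReal.ofReal (1 - p)) ≠ 0 := by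
    have := hp.1
    have := hp.2
    refine (lt_min ?_ ?_).ne' <;> rw [ENNReal.ofReal_pos] <;> linarith
  have hv : FlippingRotator.IsBond 0 (1, 0) := by simp [FlippingRotator.IsBond]
  filter_upwards [(hC.isRandomField hp).ae_return hε hv] with ω ⟨N, hN, h⟩
  exact FlippingRotator.isPeriodic_of_return hN h
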